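/- **Setting.** Let $d\in\{2,3\}$, let $\Omega\subset\mathbb R^d$ be open and bounded, $T,\nu>0$, and let $\|\cdot\|$, $(\cdot,\cdot)$ be the norm and inner product of $L^2(\Omega)$ (for scalar, vector and matrix fields). Put $X=H_0^1(\Omega;\mathbb R^d)$ and $Q=L^2_0(\Omega)=\{q\in L^2(\Omega):\int_\Omega q=0\}$. Let $\mathbf u:[0,T]\to X$, $p:[0,T]\to Q$ be a solution, with force $\mathbf f$, of the weak incompressible Navier–Stokes equations: for all $\mathbf v\in X$, $q\in Q$, $$\int_\Omega\frac{\partial\mathbf u}{\partial t}\cdot\mathbf v+\nu(\nabla\mathbf u,\nabla\mathbf v)+((\mathbf u\cdot\nabla)\mathbf u,\mathbf v)-(\nabla\cdot\mathbf v,p)=(\mathbf f,\mathbf v),\qquad(\nabla\cdot\mathbf u,q)=0,$$ where the first equation is understood in the time-integrated sense. For $\Delta t>0$ and $K\in\mathbb N$ with $K\Delta t=T$ write $\mathbf u_k=\mathbf u(k\Delta t)$, $0\le k\le K$. **Discretization.** Let $m\ge1$ be an integer, let $\mathcal T$ be a finite conforming simplicial mesh of $\overline\Omega$ with mesh size $h$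 (the largest cell diameter), and let $X^h\subset X$ be the space of continuous vector fields that are polynomials of degree at most $m+1$ on each cell. Let $s_0,\dots,s_K\in X$ be snapshots, $\mathcal C_{k\ell}=\frac1{K+1}(s_k,s_\ell)$ their correlation matrix, $R=\operatorname{rank}\mathcal C$, and $\lambda_1\ge\dots\ge\lambda_R>0$ the nonzero eigenvalues of $\mathcal C$ with multiplicity. Let $\varphi_j=\frac1{\lambda_j}\sum_{k=0}^K(v_j)_k\,s_k$, $1\le j\le R$, be the POD basis, where $\mathcal C v_j=\lambda_jv_j$ and the eigenvectors $v_j$ are chosen and scaled so that $(\varphi_i,\varphi_j)=\delta_{ij}$. For $r\le R$ let $X^r=\operatorname{span}\{\varphi_1,\dots,\varphi_r\}$, and assume $X^r\subset X^h$. Let $S^r=\big((\nabla\varphi_i,\nabla\varphi_j)\big)_{i,j\le r}$, with spectral norm $\|S^r\|_2$. Let $P^r:L^2(\Omega;\mathbb R^d)\to X^r$ be the $L^2$-orthogonal projection: $(P^r\mathbf w,\mathbf v)=(\mathbf w,\mathbf v)$ for all $\mathbf v\in X^r$. For $\delta>0$ let the ROM differential filter $F^r\mathbf w=\overline{\mathbf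 w}\in X^r$ of $\mathbf w\in L^2(\Omega;\mathbb R^d)$ be the unique solution of $$\delta^2(\nabla\overline{\mathbf w},\nabla\mathbf v)+(\overline{\mathbf w},\mathbf v)=(\mathbf w,\mathbf v)\qquad\forall\,\mathbf v\in X^r,$$ and for an integer $N\ge0$ let $D_N^r=\sum_{n=0}^N(I-F^r)^n$ be the ROM van Cittert operator. Put $$\mathcal E_0=h^{2m+4}+\Delta t^4+\sum_{j=r+1}^R\lambda_j,\qquad \mathcal E_1=h^{2m+2}+\|S^r\|_2h^{2m+4}+(1+\|S^r\|_2)\Delta t^4+\sum_{j=r+1}^R\|\nabla\varphi_j\|^2\lambda_j .$$ **Lemma.** For every $\Omega,T,\nu,\mathbf f,\mathbf u,p$ as above, every constant $C_0$ and every integer $N\ge0$ there is a constant $C(N)>0$, which does not depend on $m,\mathcal T,h,K,\Delta t$, the snapshots, $R,r,\lambda_j,\varphi_j$ or $\delta$, such that the following holds. If the pointwise POD projection error bounds $$\|\mathbf u_k-P^r\mathbf u_k\|^2\le C_0\,\mathcal E_0,\qquad \|\nabla(\mathbf u_k-P^r\mathbf u_k)\|^2\le C_0\,\mathcal E_1\qquad(0\le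 k\le K)$$ hold, then for every $0\le k\le K$ such that $\Delta\mathbf u_k\in L^2(\Omega;\mathbb R^d)$ (in the sense of distributions), $$\|\mathbf u_k-D_N^r\overline{\mathbf u_k}\|^2\le C(N)\,\mathcal E_0+C(N)\,\delta^2\,\mathcal E_1+C(N)\,\delta^4\,\|\Delta\mathbf u_k\|^2 .$$ -/

import Mathlib

open MeasureTheory Set
open scoped ContDiff

noncomputable section

namespace ROM

/-! ### Function spaces -/

/-- The physical space `ℝ^d` with its Euclidean norm. -/
abbrev Pt (d : ℕ) : Type := EuclideanSpace ℝ (Fin d)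

/-- `d × d` matrices with the Frobenius norm and inner product. -/
abbrev Mat (d : ℕ) : Type := EuclideanSpace ℝ (Fin d × Fin d)

/-- `L²(Ω; ℝ^d)`; its norm and inner product are `‖·‖` and `(·,·)`. -/
abbrev L2Vec {d : ℕ} (Ω : Set (Pt d)) : Type := Lp (Pt d) 2 (volume.restrict Ω)

/-- `L²(Ω; ℝ^{d×d})` with the inner product `(G, H) = ∫_Ω ∑ᵢⱼ Gᵢⱼ Hᵢⱼ`. -/
abbrev L2Mat {d : ℕ} (Ω : Set (Pt d)) : Type := Lp (Mat d) 2 (volume.restrict Ω)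

/-- Smooth vector fields with compact support inside `Ω`. -/
structure IsTestField {d : ℕ} (Ω : Set (Pt d)) (η : Pt d → Pt d) : Prop where
  smooth : ContDiff ℝ ∞ η
  compact : HasCompactSupport η
  support : tsupport η ⊆ Ω

/-- The classical gradient of a vector field; the entry `(i, j)` is `∂ᵢ ηⱼ`. -/
def gradField {d : ℕ} (η : Pt d → Pt d) (x : Pt d) : Mat d :=
  WithLp.toLp 2 fun ij => fderiv ℝ η x (EuclideanSpace.single ij.1 1) ij.2

/-- The pairs `(η, ∇η)`, for `η` a smooth vector field with compact support in `Ω`, as elements of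
`L²(Ω; ℝ^d) × L²(Ω; ℝ^{d×d})`. -/
def testPairs {d : ℕ} (Ω : Set (Pt d)) : Submodule ℝ (L2Vec Ω × L2Mat Ω) where
  carrier := {U | ∃ η : Pt d → Pt d, IsTestField Ω η ∧
    U.1 =ᵐ[volume.restrict Ω] η ∧ U.2 =ᵐ[volume.restrict Ω] gradField η}
  zero_mem' := by
    refine ⟨fun _ => 0, ⟨contDiff_const, HasCompactSupport.zero, ?_⟩, ?_, ?_⟩
    · have h : tsupport (fun _ : Pt d => (0 : Pt d)) = ∅ := tsupport_eq_empty_iff.2 rfl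
      simp [h]
    · exact Lp.coeFn_zero _ _ _
    · filter_upwards [Lp.coeFn_zero (Mat d) 2 (volume.restrict Ω)] with x hx
      rw [Prod.snd_zero, hx]
      ext ij
      simp [gradField]
  add_mem' := by
    rintro U V ⟨η, hη, h1, h2⟩ ⟨ζ, hζ, k1, k2⟩
    refine ⟨η + ζ, ⟨hη.smooth.add hζ.smooth, hη.compact.add hζ.compact,
      (tsupport_add η ζ).trans (union_subset hη.support hζ.support)⟩, ?_, ?_⟩
    · filter_upwards [Lp.coeFn_add U.1 V.1, h1, k1] with x hx a b
      rw [Prod.fst_add, hx, Pi.add_apply, a, b, Pi.add_apply]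
    · filter_upwards [Lp.coeFn_add U.2 V.2, h2, k2] with x hx a b
      rw [Prod.snd_add, hx, Pi.add_apply, a, b]
      have e := fderiv_add (x := x) (hη.smooth.differentiable (by simp) x)
        (hζ.smooth.differentiable (by simp) x)
      ext ij
      simp [gradField, e]
  smul_mem' := by
    rintro c U ⟨η, hη, h1, h2⟩
    refine ⟨c • η, ⟨hη.smooth.const_smul c, hη.compact.smul_left (f := fun _ => c),
      (tsupport_smul_subset_right (fun _ => c) η).trans hη.support⟩, ?_, ?_⟩
    · filter_upwards [Lp.coeFn_smul c U.1, h1] with x hx a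
      rw [Prod.smul_fst, hx, Pi.smul_apply, a, Pi.smul_apply]
    · filter_upwards [Lp.coeFn_smul c U.2, h2] with x hx a
      rw [Prod.smul_snd, hx, Pi.smul_apply, a]
      have e := fderiv_const_smul (x := x) (hη.smooth.differentiable (by simp) x) c
      ext ij
      simp [gradField, e]

/-- The space `X = H¹₀(Ω; ℝ^d)`: the closure of the smooth compactly supported fields in the
`H¹` norm. A member is stored as the pair `(u, ∇u)` of the field and its weak gradient. -/
def X {d : ℕ} (Ω : Set (Pt d)) : Submodule ℝ (L2Vec Ω × L2Mat Ω) :=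
  (testPairs Ω).topologicalClosure

/-- A member of `X`, as an element of `L²(Ω; ℝ^d)`. -/
def fn {d : ℕ} {Ω : Set (Pt d)} : X Ω →ₗ[ℝ] L2Vec Ω :=
  (LinearMap.fst ℝ (L2Vec Ω) (L2Mat Ω)).comp (X Ω).subtype

/-- The weak gradient of a member of `X`. -/
def grad {d : ℕ} {Ω : Set (Pt d)} : X Ω →ₗ[ℝ] L2Mat Ω :=
  (LinearMap.snd ℝ (L2Vec Ω) (L2Mat Ω)).comp (X Ω).subtype

/-- `g ∈ L²(Ω; ℝ^d)` is the (distributional) Laplacian of `U ∈ X`: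
`-(∇U, ∇η) = (g, η)` for all smooth fields `η` with compact support in `Ω`. -/
def IsLaplacian {d : ℕ} {Ω : Set (Pt d)} (U : X Ω) (g : L2Vec Ω) : Prop :=
  ∀ Ψ ∈ testPairs Ω, -inner ℝ (grad U) Ψ.2 = inner ℝ g Ψ.1

/-- The pressure space `Q = L²₀(Ω)` (functions of mean zero). -/
def Q {d : ℕ} (Ω : Set (Pt d)) : Set (Lp ℝ 2 (volume.restrict Ω)) :=
  {q | ∫ x in Ω, q x = 0}

/-! ### The Navier-Stokes equations -/

/-- `b(u, v, w) = ((u · ∇) v, w)`. -/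
def triForm {d : ℕ} {Ω : Set (Pt d)} (U V W : X Ω) : ℝ :=
  ∫ x in Ω, ∑ i, ∑ j, fn U x i * grad V x (i, j) * fn W x j

/-- `(∇ · v, q)`. -/
def divForm {d : ℕ} {Ω : Set (Pt d)} (V : X Ω) (q : Lp ℝ 2 (volume.restrict Ω)) : ℝ :=
  ∫ x in Ω, (∑ i, grad V x (i, i)) * q x

/-- `(u, p)` solves the weak form of the incompressible Navier-Stokes equations on `Ω × [0, T]`
with viscosity `ν`, force `f` and homogeneous Dirichlet conditions. The equation
`d/dt (u, v) + ν (∇u, ∇v) + b(u, u, v) - (∇ · v, p) = (f, v)` is integrated in time. -/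
structure IsNSESolution {d : ℕ} (Ω : Set (Pt d)) (T ν : ℝ) (f : ℝ → L2Vec Ω)
    (u : ℝ → X Ω) (p : ℝ → Lp ℝ 2 (volume.restrict Ω)) : Prop where
  pressure : ∀ t ∈ Icc 0 T, p t ∈ Q Ω
  integrable : ∀ v : X Ω, IntervalIntegrable (fun t => ν * inner ℝ (grad (u t)) (grad v)
    + triForm (u t) (u t) v - divForm v (p t) - inner ℝ (f t) (fn v)) volume 0 T
  momentum : ∀ v : X Ω, ∀ t ∈ Icc 0 T,
    inner ℝ (fn (u t)) (fn v) - inner ℝ (fn (u 0)) (fn v)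
      + ∫ τ in (0 : ℝ)..t, (ν * inner ℝ (grad (u τ)) (grad v) + triForm (u τ) (u τ) v
          - divForm v (p τ) - inner ℝ (f τ) (fn v)) = 0
  incompressible : ∀ t ∈ Icc 0 T, ∀ q ∈ Q Ω, divForm (u t) q = 0

/-! ### Finite element space -/

/-- `𝒯` is a finite conforming simplicial mesh of the closure of `Ω`. -/
structure IsMesh {d : ℕ} (Ω : Set (Pt d)) (𝒯 : Geometry.SimplicialComplex ℝ (Pt d)) : Prop where
  finite : 𝒯.faces.Finite
  covers : 𝒯.space = closure Ω
  pure : ∀ s ∈ 𝒯.faces, ∃ t ∈ 𝒯.faces, s ⊆ t ∧ t.card = d + 1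

/-- The mesh size: the largest diameter of a cell. -/
def meshSize {d : ℕ} (𝒯 : Geometry.SimplicialComplex ℝ (Pt d)) : ℝ :=
  sSup ((fun s : Finset (Pt d) => Metric.diam (convexHull ℝ (s : Set (Pt d)))) '' 𝒯.faces)

/-- Continuous vector fields which on every cell of the mesh are polynomials of degree at most
`n` in each component. -/
structure IsPiecewisePoly {d : ℕ} (𝒯 : Geometry.SimplicialComplex ℝ (Pt d)) (n : ℕ)
    (w : Pt d → Pt d) : Prop where
  cont : ContinuousOn w 𝒯.space
  poly : ∀ s ∈ 𝒯.faces, ∀ i : Fin d, ∃ q : MvPolynomial (Fin d) ℝ, q.totalDegree ≤ n ∧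
    ∀ x ∈ convexHull ℝ (s : Set (Pt d)), w x i = MvPolynomial.eval (fun j => x j) q

/-- The Taylor-Hood velocity space `Xʰ ⊂ X` of continuous piecewise polynomials of order `m + 1`. -/
def Xh {d : ℕ} (Ω : Set (Pt d)) (𝒯 : Geometry.SimplicialComplex ℝ (Pt d)) (m : ℕ) : Set (X Ω) :=
  {U | ∃ w : Pt d → Pt d, IsPiecewisePoly 𝒯 (m + 1) w ∧ fn U =ᵐ[volume.restrict Ω] w}

/-! ### Proper orthogonal decomposition -/

/-- The correlation matrix `𝒞ₖₗ = (sₖ, sₗ) / (K + 1)` of the snapshots `s₀, …, s_K`. -/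
def corrMatrix {d : ℕ} {Ω : Set (Pt d)} {K : ℕ} (s : Fin (K + 1) → X Ω) :
    Matrix (Fin (K + 1)) (Fin (K + 1)) ℝ :=
  Matrix.of fun k l => 1 / ((K : ℝ) + 1) * inner ℝ (fn (s k)) (fn (s l))

/-- `lam 1 ≥ … ≥ lam R > 0` are the nonzero eigenvalues of the correlation matrix, repeated
according to multiplicity, and `φ 1, …, φ R` is the `L²`-orthonormal POD basis
`φⱼ = λⱼ⁻¹ ∑ₖ (vⱼ)ₖ sₖ` built from eigenvectors `vⱼ`
(whose lengths are fixed by the normalization of `φⱼ`). -/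
structure IsPOD {d : ℕ} {Ω : Set (Pt d)} {K : ℕ} (s : Fin (K + 1) → X Ω) (R : ℕ)
    (lam : ℕ → ℝ) (φ : ℕ → X Ω) : Prop where
  rank : R = (corrMatrix s).rank
  pos : ∀ j ∈ Finset.Icc 1 R, 0 < lam j
  sorted : AntitoneOn lam (Icc 1 R)
  basis : ∀ j ∈ Finset.Icc 1 R, ∃ v : Fin (K + 1) → ℝ,
    (corrMatrix s).mulVec v = lam j • v ∧ φ j = (1 / lam j) • ∑ k, v k • s k
  orthonormal : ∀ i ∈ Finset.Icc 1 R, ∀ j ∈ Finset.Icc 1 R,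
    inner ℝ (fn (φ i)) (fn (φ j)) = if i = j then (1 : ℝ) else 0

/-- The ROM space `Xʳ = span {φ₁, …, φᵣ}`. -/
def Xr {d : ℕ} {Ω : Set (Pt d)} (φ : ℕ → X Ω) (r : ℕ) : Submodule ℝ (X Ω) :=
  Submodule.span ℝ (φ '' Icc 1 r)

/-- The ROM stiffness matrix `Sʳᵢⱼ = (∇φᵢ, ∇φⱼ)`, `1 ≤ i, j ≤ r`. -/
def stiffness {d : ℕ} {Ω : Set (Pt d)} (φ : ℕ → X Ω) (r : ℕ) : Matrix (Fin r) (Fin r) ℝ :=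
  Matrix.of fun i j => inner ℝ (grad (φ (i + 1))) (grad (φ (j + 1)))

/-- The spectral norm `‖Sʳ‖₂`. -/
def stiffnessNorm {d : ℕ} {Ω : Set (Pt d)} (φ : ℕ → X Ω) (r : ℕ) : ℝ :=
  ‖Matrix.toEuclideanCLM (n := Fin r) (𝕜 := ℝ) (stiffness φ r)‖

/-! ### ROM projection, ROM differential filter, ROM van Cittert operator -/

/-- `y ∈ Xʳ` and `(y, v) = (w, v)` for all `v ∈ Xʳ`. -/
def IsProjection {d : ℕ} {Ω : Set (Pt d)} (φ : ℕ → X Ω) (r : ℕ) (w : L2Vec Ω) (y : X Ω) : Prop :=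
  y ∈ Xr φ r ∧ ∀ v ∈ Xr φ r, inner ℝ (fn y) (fn v) = (inner ℝ w (fn v) : ℝ)

/-- `y ∈ Xʳ` and `δ² (∇y, ∇v) + (y, v) = (w, v)` for all `v ∈ Xʳ`. -/
def IsFiltered {d : ℕ} {Ω : Set (Pt d)} (φ : ℕ → X Ω) (r : ℕ) (δ : ℝ) (w : L2Vec Ω) (y : X Ω) :
    Prop :=
  y ∈ Xr φ r ∧ ∀ v ∈ Xr φ r,
    δ ^ 2 * inner ℝ (grad y) (grad v) + inner ℝ (fn y) (fn v) = (inner ℝ w (fn v) : ℝ)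

open Classical in
/-- The ROM projection `Pʳ(w)`; it is characterized by `existsUnique_isProjection`. -/
def proj {d : ℕ} {Ω : Set (Pt d)} (φ : ℕ → X Ω) (r : ℕ) (w : L2Vec Ω) : X Ω :=
  if h : ∃ y, IsProjection φ r w y then h.choose else 0

open Classical in
/-- The ROM differential filter `Fʳ(w)` of radius `δ`; it is characterized by
`existsUnique_isFiltered`. -/
def filt {d : ℕ} {Ω : Set (Pt d)} (φ : ℕ → X Ω) (r : ℕ) (δ : ℝ) (w : L2Vec Ω) : X Ω :=
  if h : ∃ y, IsFiltered φ r δ w y then h.choose else 0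

/-- The ROM van Cittert operator `D_Nʳ w = ∑_{n=0}^N (I - Fʳ)ⁿ w`. -/
def vanCittert {d : ℕ} {Ω : Set (Pt d)} (φ : ℕ → X Ω) (r : ℕ) (δ : ℝ) (N : ℕ) (w : L2Vec Ω) :
    L2Vec Ω :=
  ∑ n ∈ Finset.range (N + 1), (fun ψ : L2Vec Ω => ψ - fn (filt φ r δ ψ))^[n] w

/-- A definite bilinear form on a finite-dimensional space represents every functional. -/
theorem existsUnique_form {V : Type*} [AddCommGroup V] [Module ℝ V] [FiniteDimensional ℝ V]
    (B : V →ₗ[ℝ] V →ₗ[ℝ] ℝ) (hB : ∀ v, B v v = 0 → v = 0) (l : V →ₗ[ℝ] ℝ) :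
    ∃! y, ∀ v, B y v = l v := by
  have hinj : Function.Injective (B : V →ₗ[ℝ] Module.Dual ℝ V) := by
    rw [← LinearMap.ker_eq_bot, LinearMap.ker_eq_bot']
    intro v hv
    exact hB v (by rw [hv]; rfl)
  have hsur := (LinearMap.injective_iff_surjective_of_finrank_eq_finrank
    (f := (B : V →ₗ[ℝ] Module.Dual ℝ V)) Subspace.dual_finrank_eq.symm).1 hinj
  obtain ⟨y, hy⟩ := hsur l
  refine ⟨y, fun v => by rw [hy], fun z hz => hinj ?_⟩
  rw [hy]
  exact LinearMap.ext hz

instance finiteDimensional_Xr {d : ℕ} {Ω : Set (Pt d)} (φ : ℕ → X Ω) (r : ℕ) :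
    FiniteDimensional ℝ (Xr φ r) :=
  FiniteDimensional.span_of_finite ℝ ((finite_Icc 1 r).image φ)

/-- For a POD basis the ROM projection exists and is unique. -/
theorem existsUnique_isProjection {d : ℕ} {Ω : Set (Pt d)} {K : ℕ} {s : Fin (K + 1) → X Ω}
    {R : ℕ} {lam : ℕ → ℝ} {φ : ℕ → X Ω} (hP : IsPOD s R lam φ) {r : ℕ} (hr : r ≤ R)
    (w : L2Vec Ω) : (∃! y, IsProjection φ r w y) ∧ IsProjection φ r w (proj φ r w) := by
  have key : ∃! y, IsProjection φ r w y := by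
    have exp : ∀ y ∈ Xr φ r,
        y = ∑ j ∈ Finset.Icc 1 r, (inner ℝ (fn (φ j)) (fn y) : ℝ) • φ j := by
      intro y hy
      induction hy using Submodule.span_induction with
      | mem x hx =>
        obtain ⟨i, hi, rfl⟩ := hx
        have hi' : i ∈ Finset.Icc 1 r := Finset.mem_Icc.2 hi
        have : ∀ j ∈ Finset.Icc 1 r, (inner ℝ (fn (φ j)) (fn (φ i)) : ℝ) • φ j
            = if j = i then φ i else 0 := by
          intro j hj
          rw [hP.orthonormal j (Finset.Icc_subset_Icc_right hr hj) i
            (Finset.Icc_subset_Icc_right hr hi')]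
          split_ifs with h
          · rw [h, one_smul]
          · rw [zero_smul]
        rw [Finset.sum_congr rfl this, Finset.sum_ite_eq' _ _ (fun _ => φ i), if_pos hi']
      | zero => simp
      | add x y _ _ hx hy =>
        simp only [map_add, inner_add_right, add_smul, Finset.sum_add_distrib]
        rw [← hx, ← hy]
      | smul a x _ hx =>
        simp only [map_smul, inner_smul_right, mul_smul, ← Finset.smul_sum]
        rw [← hx]
    let ι : Xr φ r →ₗ[ℝ] L2Vec Ω := fn.comp (Xr φ r).subtype
    let B : Xr φ r →ₗ[ℝ] Xr φ r →ₗ[ℝ] ℝ := (innerₗ (L2Vec Ω)).compl₁₂ ι ι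
    let l : Xr φ r →ₗ[ℝ] ℝ := (innerₗ (L2Vec Ω) w).comp ι
    have hB : ∀ v : Xr φ r, B v v = 0 → v = 0 := by
      intro v hv
      have hv' : (inner ℝ (fn (v : X Ω)) (fn (v : X Ω)) : ℝ) = 0 := hv
      have h0 : fn (v : X Ω) = 0 := inner_self_eq_zero.1 hv'
      apply Subtype.ext
      rw [exp v v.2, h0]
      simp
    obtain ⟨y, hy, hu⟩ := existsUnique_form (V := Xr φ r) B hB l
    refine ⟨y, ⟨y.2, fun v hv => hy ⟨v, hv⟩⟩, fun z hz => ?_⟩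
    exact congrArg Subtype.val (hu ⟨z, hz.1⟩ fun v => hz.2 v v.2)
  refine ⟨key, ?_⟩
  unfold proj
  rw [dif_pos key.exists]
  exact key.exists.choose_spec

/-- For `δ > 0` the ROM filter exists and is unique. -/
theorem existsUnique_isFiltered {d : ℕ} {Ω : Set (Pt d)} (φ : ℕ → X Ω) (r : ℕ) {δ : ℝ}
    (hδ : 0 < δ) (w : L2Vec Ω) :
    (∃! y, IsFiltered φ r δ w y) ∧ IsFiltered φ r δ w (filt φ r δ w) := by
  have key : ∃! y, IsFiltered φ r δ w y := by
    let ι : Xr φ r →ₗ[ℝ] L2Vec Ω := fn.comp (Xr φ r).subtype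
    let κ : Xr φ r →ₗ[ℝ] L2Mat Ω := grad.comp (Xr φ r).subtype
    let B : Xr φ r →ₗ[ℝ] Xr φ r →ₗ[ℝ] ℝ :=
      δ ^ 2 • (innerₗ (L2Mat Ω)).compl₁₂ κ κ + (innerₗ (L2Vec Ω)).compl₁₂ ι ι
    let l : Xr φ r →ₗ[ℝ] ℝ := (innerₗ (L2Vec Ω) w).comp ι
    have hB : ∀ v : Xr φ r, B v v = 0 → v = 0 := by
      intro v hv
      have hv' : δ ^ 2 * inner ℝ (grad (v : X Ω)) (grad (v : X Ω))
        + inner ℝ (fn (v : X Ω)) (fn (v : X Ω)) = (0 : ℝ) := hv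
      rw [real_inner_self_eq_norm_sq, real_inner_self_eq_norm_sq] at hv'
      have hg : ‖grad (v : X Ω)‖ = 0 := by
        have h1 : 0 ≤ δ ^ 2 * ‖grad (v : X Ω)‖ ^ 2 := by positivity
        have h2 : δ ^ 2 * ‖grad (v : X Ω)‖ ^ 2 = 0 := by
          nlinarith [sq_nonneg ‖fn (v : X Ω)‖]
        simpa [hδ.ne'] using h2
      have hf : ‖fn (v : X Ω)‖ = 0 := by
        rw [hg] at hv'
        simpa using hv'
      apply Subtype.ext
      apply Subtype.ext
      exact Prod.ext (norm_eq_zero.1 hf) (norm_eq_zero.1 hg)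
    obtain ⟨y, hy, hu⟩ := existsUnique_form (V := Xr φ r) B hB l
    refine ⟨y, ⟨y.2, fun v hv => hy ⟨v, hv⟩⟩, fun z hz => ?_⟩
    exact congrArg Subtype.val (hu ⟨z, hz.1⟩ fun v => hz.2 v v.2)
  refine ⟨key, ?_⟩
  unfold filt
  rw [dif_pos key.exists]
  exact key.exists.choose_spec

/-! ### Error quantities -/

/-- `h^{2m+4} + Δt⁴ + ∑_{j=r+1}^R λⱼ`. -/
def errL2 (h Δt : ℝ) (m r R : ℕ) (lam : ℕ → ℝ) : ℝ :=
  h ^ (2 * m + 4) + Δt ^ 4 + ∑ j ∈ Finset.Icc (r + 1) R, lam j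

/-- `h^{2m+2} + ‖Sʳ‖₂ h^{2m+4} + (1 + ‖Sʳ‖₂) Δt⁴ + ∑_{j=r+1}^R ‖∇φⱼ‖² λⱼ`. -/
def errH1 {d : ℕ} {Ω : Set (Pt d)} (h Δt : ℝ) (m r R : ℕ) (lam : ℕ → ℝ) (φ : ℕ → X Ω) : ℝ :=
  h ^ (2 * m + 2) + stiffnessNorm φ r * h ^ (2 * m + 4) + (1 + stiffnessNorm φ r) * Δt ^ 4
    + ∑ j ∈ Finset.Icc (r + 1) R, ‖grad (φ j)‖ ^ 2 * lam j

/-- The pointwise in time bounds, with constant `C`, for the POD projection errors of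
`u(t₀), …, u(t_K)`, where `t_k = k Δt`. -/
def PODApproximation {d : ℕ} {Ω : Set (Pt d)} (C : ℝ) (u : ℝ → X Ω) (h Δt : ℝ) (m K r R : ℕ)
    (lam : ℕ → ℝ) (φ : ℕ → X Ω) : Prop :=
  ∀ k ≤ K,
    ‖fn (u (k * Δt) - proj φ r (fn (u (k * Δt))))‖ ^ 2 ≤ C * errL2 h Δt m r R lam ∧
    ‖grad (u (k * Δt) - proj φ r (fn (u (k * Δt))))‖ ^ 2 ≤ C * errH1 h Δt m r R lam φ

end ROM

end

namespace ROM

variable {d : ℕ} {Ω : Set (Pt d)}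

/-! Write `G = I - Fʳ`. Since `Fʳ w = w - G w`, the sum `D_Nʳ Fʳ w` telescopes and the deconvolution
error is exactly `G^{N+1} w`. The energy identity of the filter makes `G` nonexpansive in `L²` for
every `δ > 0`, so this error is at most `‖G w‖`, the error of the filter alone
(`norm_filtResidual_sq_le`). That error is split at `Pʳ w`: projection orthogonality removes the
`L²` projection error from the equation for `Fʳ w - Pʳ w`, and integration by parts against the
Laplacian makes the consistency term of order `δ²`. No inverse inequality enters. -/

/-- The Laplacian identity extends from smooth test fields to all of `X` by density. -/
theorem IsLaplacian.neg_inner_grad {U : X Ω} {g : L2Vec Ω} (h : IsLaplacian U g) (V : X Ω) :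
    -inner ℝ (grad U) (grad V) = (inner ℝ g (fn V) : ℝ) := by
  have hcl : IsClosed {Ψ : L2Vec Ω × L2Mat Ω |
      -inner ℝ (grad U) Ψ.2 = (inner ℝ g Ψ.1 : ℝ)} :=
    isClosed_eq (by fun_prop) (by fun_prop)
  have hV : (V : L2Vec Ω × L2Mat Ω) ∈ closure (testPairs Ω : Set (L2Vec Ω × L2Mat Ω)) := V.2
  exact closure_minimal (fun Ψ hΨ => h Ψ hΨ) hcl hV

/-- The ROM differential filter respects differences. -/
theorem filt_sub (φ : ℕ → X Ω) (r : ℕ) {δ : ℝ} (hδ : 0 < δ) (w z : L2Vec Ω) :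
    filt φ r δ (w - z) = filt φ r δ w - filt φ r δ z := by
  obtain ⟨hu, hf⟩ := existsUnique_isFiltered φ r hδ (w - z)
  have hw := (existsUnique_isFiltered φ r hδ w).2
  have hz := (existsUnique_isFiltered φ r hδ z).2
  -- `filt` is obtained by choice, so its additivity has to come from uniqueness of the variational
  -- solution.
  refine hu.unique hf ⟨sub_mem hw.1 hz.1, fun v hv => ?_⟩
  have h1 := hw.2 v hv
  have h2 := hz.2 v hv
  simp only [map_sub, inner_sub_left]
  linarith

/-- The residual `ψ - Fʳ ψ` of the ROM differential filter. -/
noncomputable def filtResidual (φ : ℕ → X Ω) (r : ℕ) (δ : ℝ) (ψ : L2Vec Ω) : L2Vec Ω :=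
  ψ - fn (filt φ r δ ψ)

theorem filtResidual_iterate_sub (φ : ℕ → X Ω) (r : ℕ) {δ : ℝ} (hδ : 0 < δ) (n : ℕ)
    (w z : L2Vec Ω) : (filtResidual φ r δ)^[n] (w - z)
      = (filtResidual φ r δ)^[n] w - (filtResidual φ r δ)^[n] z := by
  induction n generalizing w z with
  | zero => rfl
  | succ n ih =>
    have h : filtResidual φ r δ (w - z) = filtResidual φ r δ w - filtResidual φ r δ z := by
      simp only [filtResidual, filt_sub φ r hδ, map_sub]
      abel
    simp only [Function.iterate_succ_apply, h, ih]

/-- Testing the filter equation with `Fʳ ψ` itself gives `(ψ, Fʳψ) = δ²‖∇Fʳψ‖² + ‖Fʳψ‖²`, hence `‖ψ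
- Fʳψ‖² = ‖ψ‖² - 2δ²‖∇Fʳψ‖² - ‖Fʳψ‖²`. -/
theorem norm_filtResidual_le (φ : ℕ → X Ω) (r : ℕ) {δ : ℝ} (hδ : 0 < δ) (ψ : L2Vec Ω) :
    ‖filtResidual φ r δ ψ‖ ≤ ‖ψ‖ := by
  have hf := (existsUnique_isFiltered φ r hδ ψ).2
  have h := hf.2 _ hf.1
  rw [real_inner_self_eq_norm_sq, real_inner_self_eq_norm_sq] at h
  have hn := norm_sub_sq_real ψ (fn (filt φ r δ ψ))
  have hg : 0 ≤ δ ^ 2 * ‖grad (filt φ r δ ψ)‖ ^ 2 := by positivity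
  refine le_of_sq_le_sq ?_ (norm_nonneg _)
  unfold filtResidual
  nlinarith [sq_nonneg ‖fn (filt φ r δ ψ)‖]

theorem norm_filtResidual_iterate_le (φ : ℕ → X Ω) (r : ℕ) {δ : ℝ} (hδ : 0 < δ) (n : ℕ)
    (ψ : L2Vec Ω) : ‖(filtResidual φ r δ)^[n] ψ‖ ≤ ‖ψ‖ := by
  induction n generalizing ψ with
  | zero => rfl
  | succ n ih =>
    rw [Function.iterate_succ_apply]
    exact (ih _).trans (norm_filtResidual_le φ r hδ ψ)

/-- The van Cittert deconvolution error is `(I - Fʳ)^{N+1} w`. -/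
theorem sub_vanCittert_filt (φ : ℕ → X Ω) (r : ℕ) {δ : ℝ} (hδ : 0 < δ) (N : ℕ) (w : L2Vec Ω) :
    w - vanCittert φ r δ N (fn (filt φ r δ w)) = (filtResidual φ r δ)^[N + 1] w := by
  have hF : fn (filt φ r δ w) = w - filtResidual φ r δ w := by simp [filtResidual]
  have hD : vanCittert φ r δ N (fn (filt φ r δ w)) = ∑ n ∈ Finset.range (N + 1),
      ((filtResidual φ r δ)^[n] w - (filtResidual φ r δ)^[n + 1] w) := by
    unfold vanCittert
    refine Finset.sum_congr rfl fun n _ => ?_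
    -- With `Fʳ w = w - G w`, additivity of `Gⁿ` turns each summand into a difference of consecutive
    -- iterates.
    rw [Function.iterate_succ_apply, ← filtResidual_iterate_sub φ r hδ, ← hF]
    rfl
  rw [hD, Finset.sum_range_sub', Function.iterate_zero_apply, sub_sub_cancel]

/-- The error of the ROM differential filter, in terms of the error of any projection. -/
theorem norm_filtResidual_sq_le {φ : ℕ → X Ω} {r : ℕ} {δ : ℝ} (hδ : 0 < δ) {U y : X Ω}
    (hy : IsProjection φ r (fn U) y) {g : L2Vec Ω} (hg : IsLaplacian U g) :
    ‖filtResidual φ r δ (fn U)‖ ^ 2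
      ≤ 2 * ‖fn (U - y)‖ ^ 2 + 2 * δ ^ 2 * ‖grad (U - y)‖ ^ 2 + 2 * δ ^ 4 * ‖g‖ ^ 2 := by
  have hf := (existsUnique_isFiltered φ r hδ (fn U)).2
  set e := filt φ r δ (fn U) with he
  have hθ : e - y ∈ Xr φ r := sub_mem hf.1 hy.1
  have h1 := hf.2 _ hθ
  have h2 := hy.2 _ hθ
  have h3 := hg.neg_inner_grad (e - y)
  -- Energy identity for `θ = e - y`. Both `U` and `y` have the same `L²` product with `θ ∈ Xʳ`, so
  -- only the gradient of `U - y` survives; `-δ²(∇U, ∇θ)` becomes `δ²(g, θ)`.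
  have key : δ ^ 2 * ‖grad (e - y)‖ ^ 2 + ‖fn (e - y)‖ ^ 2
      = δ ^ 2 * inner ℝ g (fn (e - y)) + δ ^ 2 * inner ℝ (grad (U - y)) (grad (e - y)) := by
    rw [← h3, ← real_inner_self_eq_norm_sq, ← real_inner_self_eq_norm_sq]
    have a1 : (inner ℝ (grad (e - y)) (grad (e - y)) : ℝ)
        = inner ℝ (grad e) (grad (e - y)) - inner ℝ (grad y) (grad (e - y)) := by
      rw [← inner_sub_left, ← map_sub]
    have a2 : (inner ℝ (fn (e - y)) (fn (e - y)) : ℝ)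
        = inner ℝ (fn e) (fn (e - y)) - inner ℝ (fn y) (fn (e - y)) := by
      rw [← inner_sub_left, ← map_sub]
    have a3 : (inner ℝ (grad (U - y)) (grad (e - y)) : ℝ)
        = inner ℝ (grad U) (grad (e - y)) - inner ℝ (grad y) (grad (e - y)) := by
      rw [← inner_sub_left, ← map_sub]
    rw [a1, a2, a3]
    linarith
  have b1 : (inner ℝ g (fn (e - y)) : ℝ) ≤ ‖g‖ * ‖fn (e - y)‖ := real_inner_le_norm _ _
  have b2 : (inner ℝ (grad (U - y)) (grad (e - y)) : ℝ) ≤ ‖grad (U - y)‖ * ‖grad (e - y)‖ :=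
    real_inner_le_norm _ _
  have c1 := mul_le_mul_of_nonneg_left b1 (sq_nonneg δ)
  have c2 := mul_le_mul_of_nonneg_left b2 (sq_nonneg δ)
  -- Young's inequality on both products: half of `‖θ‖²` and half of `δ²‖∇θ‖²` are absorbed on the
  -- left, and the remaining gradient term is dropped.
  have hθ2 : ‖fn (e - y)‖ ^ 2 ≤ δ ^ 4 * ‖g‖ ^ 2 + δ ^ 2 * ‖grad (U - y)‖ ^ 2 := by
    have d1 := sq_nonneg (δ ^ 2 * ‖g‖ - ‖fn (e - y)‖)
    have d2 := mul_nonneg (sq_nonneg δ) (sq_nonneg (‖grad (U - y)‖ - ‖grad (e - y)‖))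
    have d3 := mul_nonneg (sq_nonneg δ) (sq_nonneg ‖grad (e - y)‖)
    linarith
  have hsplit : filtResidual φ r δ (fn U) = fn (U - y) - fn (e - y) := by
    rw [filtResidual, ← he, ← map_sub, ← map_sub, sub_sub_sub_cancel_right]
  have htri : ‖filtResidual φ r δ (fn U)‖ ≤ ‖fn (U - y)‖ + ‖fn (e - y)‖ := by
    rw [hsplit]
    exact norm_sub_le _ _
  have hsq := pow_le_pow_left₀ (norm_nonneg _) htri 2
  -- The factors 2 come from `(a + b)² ≤ 2a² + 2b²`.
  nlinarith [sq_nonneg (‖fn (U - y)‖ - ‖fn (e - y)‖)]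

/-- Positivity of the discarded eigenvalues and even exponents suffice, whatever the signs of `h`
and `Δt`. It allows constants multiplying the error quantity to be enlarged. -/
theorem IsPOD.errL2_nonneg {K : ℕ} {s : Fin (K + 1) → X Ω} {R : ℕ} {lam : ℕ → ℝ} {φ : ℕ → X Ω}
    (hP : IsPOD s R lam φ) (h Δt : ℝ) (m r : ℕ) : 0 ≤ errL2 h Δt m r R lam := by
  have h1 : 0 ≤ h ^ (2 * m + 4) := Even.pow_nonneg ⟨m + 2, by ring⟩ h
  have h2 : 0 ≤ ∑ j ∈ Finset.Icc (r + 1) R, lam j := Finset.sum_nonneg fun j hj =>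
    (hP.pos j (Finset.Icc_subset_Icc_left (by omega) hj)).le
  unfold errL2
  positivity

theorem IsPOD.errH1_nonneg {K : ℕ} {s : Fin (K + 1) → X Ω} {R : ℕ} {lam : ℕ → ℝ} {φ : ℕ → X Ω}
    (hP : IsPOD s R lam φ) (h Δt : ℝ) (m r : ℕ) : 0 ≤ errH1 h Δt m r R lam φ := by
  have h1 : 0 ≤ h ^ (2 * m + 4) := Even.pow_nonneg ⟨m + 2, by ring⟩ h
  have h2 : 0 ≤ h ^ (2 * m + 2) := Even.pow_nonneg ⟨m + 1, by ring⟩ h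
  have h3 : 0 ≤ stiffnessNorm φ r := norm_nonneg _
  have h4 : 0 ≤ ∑ j ∈ Finset.Icc (r + 1) R, ‖grad (φ j)‖ ^ 2 * lam j :=
    Finset.sum_nonneg fun j hj => mul_nonneg (sq_nonneg _)
      (hP.pos j (Finset.Icc_subset_Icc_left (by omega) hj)).le
  unfold errH1
  positivity

end ROM

theorem lemma3p8 {d : ℕ} (hd : d = 2 ∨ d = 3) (Ω : Set (ROM.Pt d)) (hΩ : IsOpen Ω)
    (hΩb : Bornology.IsBounded Ω) (T ν : ℝ) (hT : 0 < T) (hν : 0 < ν)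
    (f : ℝ → ROM.L2Vec Ω) (u : ℝ → ROM.X Ω) (p : ℝ → Lp ℝ 2 (volume.restrict Ω))
    (hu : ROM.IsNSESolution Ω T ν f u p) (C₀ : ℝ) (N : ℕ) :
    ∃ C : ℝ, 0 < C ∧
      ∀ (m : ℕ) (𝒯 : Geometry.SimplicialComplex ℝ (ROM.Pt d)) (h : ℝ) (K : ℕ) (Δt : ℝ)
        (s : Fin (K + 1) → ROM.X Ω) (R r : ℕ) (lam : ℕ → ℝ) (φ : ℕ → ROM.X Ω) (δ : ℝ),
        1 ≤ m → ROM.IsMesh Ω 𝒯 → h = ROM.meshSize 𝒯 →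
        0 < Δt → K * Δt = T →
        ROM.IsPOD s R lam φ → r ≤ R → (ROM.Xr φ r : Set (ROM.X Ω)) ⊆ ROM.Xh Ω 𝒯 m →
        0 < δ →
        ROM.PODApproximation C₀ u h Δt m K r R lam φ →
        ∀ k ≤ K, ∀ Δu : ROM.L2Vec Ω, ROM.IsLaplacian (u (k * Δt)) Δu →
          ‖ROM.fn (u (k * Δt))
              - ROM.vanCittert φ r δ N (ROM.fn (ROM.filt φ r δ (ROM.fn (u (k * Δt)))))‖ ^ 2
            ≤ C * ROM.errL2 h Δt m r R lam
              + C * δ ^ 2 * ROM.errH1 h Δt m r R lam φ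
              + C * δ ^ 4 * ‖Δu‖ ^ 2 := by
  -- `2|C₀|` serves the two projection errors and `2` the Laplacian term. The value is uniform in
  -- `N` because `G` is nonexpansive; the absolute value covers negative `C₀`.
  refine ⟨2 * |C₀| + 2, by positivity, ?_⟩
  intro m 𝒯 h K Δt s R r lam φ δ _ _ _ _ _ hP hr _ hδ happ k hk Δu hΔ
  obtain ⟨hL, hH⟩ := happ k hk
  have hy := (ROM.existsUnique_isProjection hP hr (ROM.fn (u (k * Δt)))).2
  have hmain := ROM.norm_filtResidual_sq_le hδ hy hΔ
  have hL0 := hP.errL2_nonneg h Δt m r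
  have hH0 := hP.errH1_nonneg h Δt m r
  have hL1 := hL.trans (mul_le_mul_of_nonneg_right (le_abs_self C₀) hL0)
  have hH1 := mul_le_mul_of_nonneg_left
    (hH.trans (mul_le_mul_of_nonneg_right (le_abs_self C₀) hH0)) (sq_nonneg δ)
  -- One factor `G` is kept for the filter error; the other `N` do not increase the norm.
  have hcontr : ‖(ROM.filtResidual φ r δ)^[N + 1] (ROM.fn (u (k * Δt)))‖ ^ 2
      ≤ ‖ROM.filtResidual φ r δ (ROM.fn (u (k * Δt)))‖ ^ 2 := by
    rw [Function.iterate_succ_apply]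
    exact pow_le_pow_left₀ (norm_nonneg _) (ROM.norm_filtResidual_iterate_le φ r hδ N _) 2
  rw [ROM.sub_vanCittert_filt φ r hδ]
  -- The common constant exceeds what each term needs; these signs, with `hL0`, let the surplus be
  -- discarded.
  have hδH : 0 ≤ δ ^ 2 * ROM.errH1 h Δt m r R lam φ := mul_nonneg (sq_nonneg δ) hH0
  have hδg : 0 ≤ |C₀| * (δ ^ 4 * ‖Δu‖ ^ 2) := by positivity
  linarith
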